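/- Work in first-order logic with equality; terms, atoms and formulas are built as usual over a signature of function and predicate symbols (constants are the function symbols of arity 0), and a name is a ground term. First-order autoepistemic formulas additionally allow a modal operator $\mathsf L$. For a first-order interpretation $w$, a variable assignment $B$ and a set $\Gamma$ of sentences, $(w,B)\models_\Gamma \mathsf L\phi$ means (any-name semantics) that, for some partial function $\beta$ from variables to names, defined exactly on the variables $x$ for which $x^B$ is the denotation of a name and such that $\beta(x)^w=x^B$ there, the formula $\phi\beta$ is closed and belongs to $\Gamma$; the other clauses are the classical ones. Further, $\Delta\models_\Gamma\phi$ means that every interpretation which, together with $\Gamma$, satisfies $\Delta$ (under all assignments) also satisfies $\phi$. A stable expansion of $\Delta$ is a set $T$ of sentences with $T=\{\phi \text{ a sentence}\mid \Delta\models_T\phi\}$. Write $\Delta_1\equiv_{oga}\Delta_2$ if for each stable expansion $T$ of $\Delta_1$ there is a stable expansion $T'$ of $\Delta_2$ that contains the same ground atomic formulas (including equalities) without $\mathsf L$, and vice versa. A normal program $P$ is a set of rules $h\leftarrow b_1,\dots,b_m,\mathit{not}\,c_1,\dots,\mathit{not}\,c_n$ with equality-free atoms. It has a signature $\Sigma_P$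 which contains the symbols occurring in $P$ and which contains a constant if it contains a predicate symbol of positive arity. The program is positive if $n=0$ in all rules, and safe if every variable of a rule occurs in some $b_i$. For a signature $\Sigma'$, let $\mathrm{UNA}_{\Sigma'}$ be the set of all $\lnot\mathsf L(t_1=t_2)\supset t_1\neq t_2$ for distinct names $t_1,t_2$ over $\Sigma'$. With $(\forall)$ denoting universal closure, put $$\tau_{HP}(r)=(\forall)\,\textstyle\bigwedge_i b_i\land\bigwedge_j\lnot\mathsf L c_j\supset h,$$ $$\tau_{EB}(r)=(\forall)\,\textstyle\bigwedge_i (b_i\land\mathsf L b_i)\land\bigwedge_j\lnot\mathsf L c_j\supset h,$$ $$\tau_{EH}(r)=(\forall)\,\textstyle\bigwedge_i (b_i\land\mathsf L b_i)\land\bigwedge_j\lnot\mathsf L c_j\supset h\land\mathsf L h,$$ and, for $\chi\in\{HP,EB,EH\}$, an $\mathsf L$-free theory $\Phi$ and a normal program $P$, $\iota_\chi(\Phi,P)=\Phi\cup\{\tau_\chi(r)\mid r\in P\}\cup \mathrm{UNA}_{\Sigma_P}$. A generalized Horn theory is a set of sentences $(\forall)\,b_1\land\dots\land b_n\supset\exists\vec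 y.\,h$ with $b_i,h$ atomic (equalities allowed), where the variables $\vec y$ occur only in $h$ and $h$ may be absent; it is a Horn theory if no $\exists\vec y$ is used. A program $P$ is DL-safe (with respect to $\Phi$) if it is safe and every variable of each rule is one of the arguments $t_1,\dots,t_k$ of some positive body atom $p(t_1,\dots,t_k)$ of that rule whose predicate $p$ does not occur in $\Phi$. Let $\Sigma$ be the combined signature of $\Phi$ and $P$, and let $gr(P)$ be the set of all ground instances of the rules of $P$ under substitutions of names over $\Sigma$ for the variables, regarded as a program with any signature $\Sigma'$ such that $\Sigma_P\subseteq\Sigma'\subseteq\Sigma$ (which only affects its axioms $\mathrm{UNA}_{\Sigma'}$). The combination $\iota_\chi$ fulfills grounding invariance for a class of pairs $(\Phi,P)$ if $\iota_\chi(\Phi,P)\equiv_{oga}\iota_\chi(\Phi,gr(P))$ for all pairs in the class and all such $\Sigma'$. **Proposition.** The following combinations fulfill grounding invariance: 1. $\iota_{EB}$ and $\iota_{EH}$ for generalized Horn theories $\Phi$ and safe positive normal programs $P$; 2. $\iota_{HP}$, $\iota_{EB}$ and $\iota_{EH}$ for Horn theories $\Phi$ and safe positive normal programs $P$; 3. $\iota_{HP}$,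 $\iota_{EB}$ and $\iota_{EH}$ for generalized Horn theories $\Phi$ and DL-safe positive normal programs $P$. -/

import Mathlib

universe u v

namespace AEL

open FirstOrder.Language

/-! ### Syntax of first-order autoepistemic logic with equality

A signature is a first-order language `L` of Mathlib; constants are function symbols of arity 0.
The variables are the natural numbers. -/

/-- Names: the ground terms of the signature. -/
abbrev Name (L : FirstOrder.Language.{u, v}) := L.Term Empty

/-- A name, regarded as a term over the variables. -/
def Name.toTerm {L : FirstOrder.Language.{u, v}} (t : Name L) : L.Term ℕ :=
  t.relabel (Empty.elim : Empty → ℕ)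

/-- Formulas of the modal language over `L`. The primitive symbols are `¬`, `∧`, `∃` and the modal
operator (`know φ` is `𝖫 φ`). -/
inductive MFormula (L : FirstOrder.Language.{u, v}) : Type (max u v)
  | equal (t₁ t₂ : L.Term ℕ) : MFormula L
  | rel {n : ℕ} (R : L.Relations n) (ts : Fin n → L.Term ℕ) : MFormula L
  | neg (φ : MFormula L) : MFormula L
  | conj (φ ψ : MFormula L) : MFormula L
  | ex (x : ℕ) (φ : MFormula L) : MFormula L
  | know (φ : MFormula L) : MFormula L

/-- The function symbols that occur in a term. -/
def termFns {L : FirstOrder.Language.{u, v}} {α : Type*} : L.Term α → Set (Σ n, L.Functions n)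
  | .var _ => ∅
  | .func (l := n) f ts => {⟨n, f⟩} ∪ ⋃ i, termFns (ts i)

/-- Name substitutions: partial functions from variables to names. -/
abbrev NameSubst (L : FirstOrder.Language.{u, v}) := ℕ → Option (Name L)

/-- Application of a name substitution to a term. -/
def substTerm {L : FirstOrder.Language.{u, v}} (β : NameSubst L) (t : L.Term ℕ) : L.Term ℕ :=
  t.subst fun x => (β x).elim (.var x) Name.toTerm

namespace MFormula

variable {L : FirstOrder.Language.{u, v}}

/-- `φ ∨ ψ` is short for `¬(¬φ ∧ ¬ψ)`. -/
def disj (φ ψ : MFormula L) : MFormula L := neg (conj (neg φ) (neg ψ))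

/-- `φ ⊃ ψ` is short for `¬φ ∨ ψ`. -/
def imp (φ ψ : MFormula L) : MFormula L := disj (neg φ) ψ

/-- `∀ x. φ` is short for `¬∃ x. ¬φ`. -/
def all (x : ℕ) (φ : MFormula L) : MFormula L := neg (ex x (neg φ))

/-- A contradictory sentence, the consequent of implications whose head is absent. -/
def falsum : MFormula L := ex 0 (neg (equal (.var 0) (.var 0)))

/-- `φ₁ ∧ ⋯ ∧ φₙ ⊃ ψ`; this is `ψ` itself if `n = 0`. -/
def impList : List (MFormula L) → MFormula L → MFormula L
  | [], ψ => ψ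
  | φ :: φs, ψ => imp (φs.foldl conj φ) ψ

/-- `∃ y₁ … yₘ. φ`. -/
def exList (ys : List ℕ) (φ : MFormula L) : MFormula L := ys.foldr ex φ

/-- The free variables of a formula. -/
def freeVars : MFormula L → Finset ℕ
  | equal t₁ t₂ => t₁.varFinset ∪ t₂.varFinset
  | rel _ ts => Finset.univ.biUnion fun i => (ts i).varFinset
  | neg φ => φ.freeVars
  | conj φ ψ => φ.freeVars ∪ ψ.freeVars
  | ex x φ => φ.freeVars.erase x
  | know φ => φ.freeVars

/-- Sentences. -/
def Closed (φ : MFormula L) : Prop := φ.freeVars = ∅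

/-- The universal closure `(∀) φ`. -/
def closure (φ : MFormula L) : MFormula L := φ.freeVars.sort.foldr all φ

/-- Atomic formulas (of first-order logic, including equalities). -/
def IsAtomic : MFormula L → Prop
  | equal _ _ => True
  | rel _ _ => True
  | _ => False

/-- Objective ground atomic formulas. -/
def IsGroundAtom (φ : MFormula L) : Prop := φ.IsAtomic ∧ φ.Closed

/-- The predicate symbols that occur in a formula. -/
def preds : MFormula L → Set (Σ n, L.Relations n)
  | equal _ _ => ∅
  | rel (n := n) R _ => {⟨n, R⟩}
  | neg φ => φ.preds
  | conj φ ψ => φ.preds ∪ ψ.preds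
  | ex _ φ => φ.preds
  | know φ => φ.preds

/-- Application of a name substitution: the free occurrences of the variables in its domain are
replaced. -/
def applySubst : NameSubst L → MFormula L → MFormula L
  | β, equal t₁ t₂ => equal (substTerm β t₁) (substTerm β t₂)
  | β, rel R ts => rel R fun i => substTerm β (ts i)
  | β, neg φ => neg (φ.applySubst β)
  | β, conj φ ψ => conj (φ.applySubst β) (ψ.applySubst β)
  | β, ex x φ => ex x (φ.applySubst (Function.update β x none))
  | β, know φ => know (φ.applySubst β)

end MFormula

/-! ### Any-name semantics and stable expansions -/

section Semantics

variable {L : FirstOrder.Language.{u, v}}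

/-- The name substitution `β` is associated with the variable assignment `B`: its domain is the set
of the variables that `B` sends to a named individual, and `x^B = β(x)^w` for each of these. -/
def Associated {U : Type*} [L.Structure U] (B : ℕ → U) (β : NameSubst L) : Prop :=
  ∀ x, match β x with
    | some t => t.realize (Empty.elim : Empty → U) = B x
    | none => ¬ ∃ t : Name L, t.realize (Empty.elim : Empty → U) = B x

/-- Satisfaction `(w, B) ⊨_Γ φ` under the any-name semantics. -/
def Sat (Γ : Set (MFormula L)) {U : Type*} [L.Structure U] : MFormula L → (ℕ → U) → Prop
  | .equal t₁ t₂, B => t₁.realize B = t₂.realize B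
  | .rel R ts, B => Structure.RelMap R fun i => (ts i).realize B
  | .neg φ, B => ¬ Sat Γ φ B
  | .conj φ ψ, B => Sat Γ φ B ∧ Sat Γ ψ B
  | .ex x φ, B => ∃ k : U, Sat Γ φ (Function.update B x k)
  | .know φ, B => ∃ β : NameSubst L, Associated B β ∧ (φ.applySubst β).Closed ∧ φ.applySubst β ∈ Γ

/-- The interpretation `⟨w, Γ⟩`, with `w` of domain `U`, is a model of `φ`. -/
def IsModel (Γ : Set (MFormula L)) (U : Type*) [L.Structure U] (φ : MFormula L) : Prop :=
  ∀ B : ℕ → U, Sat Γ φ B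

/-- Entailment `Δ ⊨_Γ φ` with respect to a belief set, under the any-name semantics. -/
def Entails (Δ Γ : Set (MFormula L)) (φ : MFormula L) : Prop :=
  ∀ (U : Type (max u v)) [Nonempty U] [L.Structure U],
    (∀ ψ ∈ Δ, IsModel Γ U ψ) → IsModel Γ U φ

/-- `T` is a stable expansion of `Δ` (under the any-name semantics). -/
def IsStableExpansion (Δ T : Set (MFormula L)) : Prop :=
  T = {φ | φ.Closed ∧ Entails Δ T φ}

/-- The restriction of a set of sentences to the objective ground atomic formulas. -/
def oga (T : Set (MFormula L)) : Set (MFormula L) := {φ ∈ T | φ.IsGroundAtom}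

/-- The stable expansions of `Δ₁` and of `Δ₂` have the same restrictions to objective ground
atomic formulas. -/
def EquivOga (Δ₁ Δ₂ : Set (MFormula L)) : Prop :=
  (∀ T, IsStableExpansion Δ₁ T → ∃ T', IsStableExpansion Δ₂ T' ∧ oga T = oga T') ∧
  (∀ T', IsStableExpansion Δ₂ T' → ∃ T, IsStableExpansion Δ₁ T ∧ oga T = oga T')

end Semantics

/-! ### Classes of first-order theories -/

section Theories

variable {L : FirstOrder.Language.{u, v}}

/-- Generalized Horn formulas `(∀) b₁ ∧ ⋯ ∧ bₙ ⊃ ∃ y₁ … yₘ. h`, with `bᵢ` and `h` atomic and the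
variables `yⱼ` occurring only in `h`, which may be absent. -/
def IsGHorn (φ : MFormula L) : Prop :=
  ∃ body : List (MFormula L), (∀ b ∈ body, b.IsAtomic) ∧
    ((∃ (h : MFormula L) (ys : List ℕ), h.IsAtomic ∧ (∀ y ∈ ys, ∀ b ∈ body, y ∉ b.freeVars) ∧
        φ = (MFormula.impList body (MFormula.exList ys h)).closure) ∨
      φ = (MFormula.impList body .falsum).closure)

/-- Horn formulas `(∀) b₁ ∧ ⋯ ∧ bₙ ⊃ h`, with `bᵢ` and `h` atomic, where `h` may be absent. -/
def IsHorn (φ : MFormula L) : Prop :=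
  ∃ body : List (MFormula L), (∀ b ∈ body, b.IsAtomic) ∧
    ((∃ h : MFormula L, h.IsAtomic ∧ φ = (MFormula.impList body h).closure) ∨
      φ = (MFormula.impList body .falsum).closure)

/-- Generalized Horn theories. -/
def GHornTheory (Φ : Set (MFormula L)) : Prop := ∀ φ ∈ Φ, IsGHorn φ

/-- Horn theories. -/
def HornTheory (Φ : Set (MFormula L)) : Prop := ∀ φ ∈ Φ, IsHorn φ

end Theories

/-! ### Normal logic programs -/

/-- Equality-free atoms `p(t₁, …, tₙ)`. -/
structure Atom (L : FirstOrder.Language.{u, v}) where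
  arity : ℕ
  pred : L.Relations arity
  args : Fin arity → L.Term ℕ

namespace Atom

variable {L : FirstOrder.Language.{u, v}}

def toFormula (a : Atom L) : MFormula L := .rel a.pred a.args

/-- The variables that occur in an atom. -/
def vars (a : Atom L) : Finset ℕ := Finset.univ.biUnion fun i => (a.args i).varFinset

/-- The function symbols that occur in an atom. -/
def fns (a : Atom L) : Set (Σ n, L.Functions n) := ⋃ i, termFns (a.args i)

def applySubst (β : NameSubst L) (a : Atom L) : Atom L :=
  ⟨a.arity, a.pred, fun i => substTerm β (a.args i)⟩

end Atom

/-- Normal rules `h ← b₁, …, bₘ, not c₁, …, not cₙ`. -/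
structure Rule (L : FirstOrder.Language.{u, v}) where
  head : Atom L
  pos : List (Atom L)
  neg : List (Atom L)

namespace Rule

variable {L : FirstOrder.Language.{u, v}}

/-- All the atoms of a rule. -/
def atoms (r : Rule L) : List (Atom L) := r.head :: (r.pos ++ r.neg)

/-- `x` occurs in the rule. -/
def HasVar (r : Rule L) (x : ℕ) : Prop := ∃ a ∈ r.atoms, x ∈ a.vars

def applySubst (β : NameSubst L) (r : Rule L) : Rule L :=
  ⟨r.head.applySubst β, r.pos.map (Atom.applySubst β), r.neg.map (Atom.applySubst β)⟩

def IsGround (r : Rule L) : Prop := ∀ x, ¬ r.HasVar x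

/-- The rule has no negated body atoms. -/
def IsPositive (r : Rule L) : Prop := r.neg = []

/-- Every variable of the rule occurs in a positive body atom. -/
def IsSafe (r : Rule L) : Prop := ∀ x, r.HasVar x → ∃ b ∈ r.pos, x ∈ b.vars

end Rule

/-- A normal logic program: a set of normal rules, with a signature (its function and predicate
symbols), which is a part of the ambient signature `L`. -/
structure Program (L : FirstOrder.Language.{u, v}) where
  rules : Set (Rule L)
  fns : Set (Σ n, L.Functions n)
  preds : Set (Σ n, L.Relations n)

namespace Program

variable {L : FirstOrder.Language.{u, v}}

/-- The signature of a program contains the symbols that occur in its rules, and it contains a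
constant if it has predicate symbols of arity greater than 0. -/
structure WellFormed (P : Program L) : Prop where
  fns_mem : ∀ r ∈ P.rules, ∀ a ∈ r.atoms, a.fns ⊆ P.fns
  preds_mem : ∀ r ∈ P.rules, ∀ a ∈ r.atoms, (⟨a.arity, a.pred⟩ : Σ n, L.Relations n) ∈ P.preds
  exists_constant : (∃ p ∈ P.preds, 0 < p.1) → ∃ c : L.Functions 0, (⟨0, c⟩ : Σ n, L.Functions n) ∈ P.fns

def IsPositive (P : Program L) : Prop := ∀ r ∈ P.rules, r.IsPositive

def IsSafe (P : Program L) : Prop := ∀ r ∈ P.rules, r.IsSafe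

/-- `a` is a rule atom with respect to the theory `Φ`: its predicate does not occur in `Φ`. -/
def RuleAtom (Φ : Set (MFormula L)) (a : Atom L) : Prop :=
  ∀ φ ∈ Φ, (⟨a.arity, a.pred⟩ : Σ n, L.Relations n) ∉ φ.preds

/-- DL-safety: the program is safe, and every variable of a rule is an argument of some rule atom
in the positive body of that rule. -/
def IsDLSafe (Φ : Set (MFormula L)) (P : Program L) : Prop :=
  P.IsSafe ∧ ∀ r ∈ P.rules, ∀ x, r.HasVar x →
    ∃ b ∈ r.pos, RuleAtom Φ b ∧ ∃ i, b.args i = .var x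

/-- The grounding of a program: all ground instances of its rules under substitutions of names of
the ambient signature `L` for the variables. Its signature has the function symbols `F`. -/
def ground (P : Program L) (F : Set (Σ n, L.Functions n)) : Program L where
  rules := {r' | r'.IsGround ∧ ∃ r ∈ P.rules, ∃ β : NameSubst L, r' = r.applySubst β}
  fns := F
  preds := P.preds

end Program

/-! ### Embeddings and combinations -/

section Embeddings

variable {L : FirstOrder.Language.{u, v}}

/-- The three embeddings: Horn for positive rules, epistemic rule bodies, epistemic rule heads. -/
inductive Emb
  | HP | EB | EH

/-- The conjunct(s) contributed by a positive body atom: `b`, or `b ∧ 𝖫 b`. -/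
def embedPos : Emb → Atom L → MFormula L
  | .HP, b => b.toFormula
  | .EB, b => .conj b.toFormula (.know b.toFormula)
  | .EH, b => .conj b.toFormula (.know b.toFormula)

/-- The embedded head: `h`, or `h ∧ 𝖫 h`. -/
def embedHead : Emb → Atom L → MFormula L
  | .HP, h => h.toFormula
  | .EB, h => h.toFormula
  | .EH, h => .conj h.toFormula (.know h.toFormula)

/-- The embedding of a normal rule; a negated body atom `not c` becomes `¬ 𝖫 c`. -/
def embedRule (χ : Emb) (r : Rule L) : MFormula L :=
  (MFormula.impList (r.pos.map (embedPos χ) ++ r.neg.map fun c => .neg (.know c.toFormula))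
    (embedHead χ r.head)).closure

/-- Default uniqueness of names, `¬ 𝖫 (t₁ = t₂) ⊃ t₁ ≠ t₂`, for all distinct names `t₁, t₂` over
the function symbols `F`. -/
def UNA (F : Set (Σ n, L.Functions n)) : Set (MFormula L) :=
  {φ | ∃ t₁ t₂ : Name L, t₁ ≠ t₂ ∧ termFns t₁ ⊆ F ∧ termFns t₂ ⊆ F ∧
    φ = .imp (.neg (.know (.equal t₁.toTerm t₂.toTerm))) (.neg (.equal t₁.toTerm t₂.toTerm))}

/-- The embedding of a normal program. -/
def embed (χ : Emb) (P : Program L) : Set (MFormula L) := embedRule χ '' P.rules ∪ UNA P.fns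

/-- The combination of a first-order theory and a normal program. -/
def combine (χ : Emb) (Φ : Set (MFormula L)) (P : Program L) : Set (MFormula L) :=
  Φ ∪ embed χ P

/-- The combination `χ` is invariant under grounding for the pairs `(Φ, P)` in the class `C`. The
ambient signature `L` is the combined signature of `Φ` and `P`; the signature of the grounded
program may be any extension, within `L`, of that of `P` (it only matters for the axioms `UNA`). -/
def GroundingInvariant (χ : Emb) (C : Set (MFormula L) → Program L → Prop) : Prop :=
  ∀ (Φ : Set (MFormula L)) (P : Program L), P.WellFormed → C Φ P →
    ∀ F : Set (Σ n, L.Functions n), P.fns ⊆ F →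
      EquivOga (combine χ Φ P) (combine χ Φ (P.ground F))

end Embeddings

end AEL

/-! In these combinations `𝖫` is applied to atoms only, so a stable expansion is determined by its
ground atoms: they form a set `S` of exactly those ground atoms that hold in all models of the
theory with respect to `S` (`IsAtomicExpansion`), and every such `S` comes from a stable expansion.
It remains to show that both combinations have the same atomic expansions.

Fix `S`. Generalized Horn sentences and embedded positive safe rules survive direct products, as
long as the ground atoms true in the product lie in `S`. Hence only models whose true ground atoms
lie in `S` need to be compared (`IsAtomicExpansion.transfer`). In such a model every true ground
atom is believed: the axioms `UNA` hold automatically, whatever their signature, and `𝖫 a` follows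
from `a` as soon as the variables of `a` denote named individuals.

Such a model of `P` is a model of the grounding. Conversely, a model of the grounding satisfies the
rules of `P` for named individuals. For EB and EH, safety and the conjuncts `𝖫 b` exclude all
others. For HP the model is modified without changing its ground atoms: if `Φ` is Horn, pass to the
substructure of named individuals; if the program is DL-safe, keep the domain and restrict the
predicates that do not occur in `Φ` to named individuals. -/

namespace AEL

open FirstOrder.Language

variable {L : FirstOrder.Language.{u, v}}

/-! ### Interpretations and the ground atoms true in them -/

/-- First-order interpretations in the universe over which entailment quantifies. -/
structure Interp (L : FirstOrder.Language.{u, v}) where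
  carrier : Type (max u v)
  [nonempty : Nonempty carrier]
  [str : L.Structure carrier]

attribute [instance] Interp.nonempty Interp.str

/-- The ground atoms that are true in an interpretation. -/
def Interp.truths (N : Interp L) : Set (MFormula L) :=
  {φ | φ.IsGroundAtom ∧ IsModel ∅ N.carrier φ}

/-- The models of `Δ` with respect to the belief set `Γ`. -/
def models (Δ Γ : Set (MFormula L)) : Set (Interp L) :=
  {N | ∀ ψ ∈ Δ, IsModel Γ N.carrier ψ}

theorem entails_iff {Δ Γ : Set (MFormula L)} {φ : MFormula L} :
    Entails Δ Γ φ ↔ ∀ N ∈ models Δ Γ, IsModel Γ N.carrier φ :=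
  ⟨fun h N hN => h N.carrier hN, fun h U _ _ hU => h ⟨U⟩ hU⟩

theorem realize_congr {U : Type*} [L.Structure U] {α : Type*} [DecidableEq α] (t : L.Term α)
    {B B' : α → U} (h : ∀ x ∈ t.varFinset, B x = B' x) : t.realize B = t.realize B' := by
  induction t with
  | var x => exact h x (by simp [FirstOrder.Language.Term.varFinset])
  | func f ts ih =>
    simp only [FirstOrder.Language.Term.realize_func]
    congr 1
    funext i
    refine ih i fun x hx => h x ?_
    simp only [FirstOrder.Language.Term.varFinset, Finset.mem_biUnion, Finset.mem_univ, true_and]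
    exact ⟨i, hx⟩

theorem sat_atomic_congr {U : Type*} [L.Structure U] {Γ Γ' : Set (MFormula L)} {φ : MFormula L}
    (hφ : φ.IsAtomic) {B B' : ℕ → U} (h : ∀ x ∈ φ.freeVars, B x = B' x) :
    Sat Γ φ B ↔ Sat Γ' φ B' := by
  cases φ with
  | equal t₁ t₂ =>
    simp only [Sat]
    rw [realize_congr t₁ fun x hx => h x (by simp [MFormula.freeVars, hx]),
      realize_congr t₂ fun x hx => h x (by simp [MFormula.freeVars, hx])]
  | rel R ts =>
    simp only [Sat]
    have : (fun i => (ts i).realize B) = fun i => (ts i).realize B' := by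
      funext i
      refine realize_congr _ fun x hx => h x ?_
      simp only [MFormula.freeVars, Finset.mem_biUnion, Finset.mem_univ, true_and]
      exact ⟨i, hx⟩
    rw [this]
  | _ => exact hφ.elim

theorem sat_groundAtom {U : Type*} [L.Structure U] {Γ Γ' : Set (MFormula L)} {φ : MFormula L}
    (hφ : φ.IsGroundAtom) (B B' : ℕ → U) : Sat Γ φ B ↔ Sat Γ' φ B' :=
  sat_atomic_congr hφ.1 fun x hx => by rw [hφ.2] at hx; simp at hx

theorem Interp.mem_truths_iff {N : Interp L} {φ : MFormula L} (hφ : φ.IsGroundAtom)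
    (Γ : Set (MFormula L)) (B : ℕ → N.carrier) : φ ∈ N.truths ↔ Sat Γ φ B :=
  ⟨fun h => (sat_groundAtom hφ B B).1 (h.2 B), fun h => ⟨hφ, fun B' => (sat_groundAtom hφ B B').1 h⟩⟩

theorem Interp.mem_truths_iff_isModel {N : Interp L} {φ : MFormula L} (hφ : φ.IsGroundAtom)
    (Γ : Set (MFormula L)) : φ ∈ N.truths ↔ IsModel Γ N.carrier φ :=
  ⟨fun h B => (N.mem_truths_iff hφ Γ B).1 h,
    fun h => (N.mem_truths_iff hφ Γ fun _ => Classical.arbitrary _).2 (h _)⟩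

/-! ### Stable sets generated by a class of interpretations -/

namespace MFormula

/-- The nesting depth of the modal operator. -/
def knowDepth : MFormula L → ℕ
  | equal _ _ => 0
  | rel _ _ => 0
  | neg φ => φ.knowDepth
  | conj φ ψ => max φ.knowDepth ψ.knowDepth
  | ex _ φ => φ.knowDepth
  | know φ => φ.knowDepth + 1

theorem knowDepth_applySubst (φ : MFormula L) (β : NameSubst L) :
    (φ.applySubst β).knowDepth = φ.knowDepth := by
  induction φ generalizing β <;> simp_all [applySubst, knowDepth]

/-- The modal operator is applied to atomic formulas only. -/
def KnowsAtoms : MFormula L → Prop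
  | equal _ _ => True
  | rel _ _ => True
  | neg φ => φ.KnowsAtoms
  | conj φ ψ => φ.KnowsAtoms ∧ ψ.KnowsAtoms
  | ex _ φ => φ.KnowsAtoms
  | know φ => φ.IsAtomic

theorem IsAtomic.applySubst {φ : MFormula L} (h : φ.IsAtomic) (β : NameSubst L) :
    (φ.applySubst β).IsAtomic := by
  cases φ <;> trivial

theorem IsAtomic.knowsAtoms {φ : MFormula L} (h : φ.IsAtomic) : φ.KnowsAtoms := by
  cases φ <;> trivial

end MFormula

/-- The belief set is consulted only about instances of arguments of `𝖫`, which have smaller modal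
depth. This makes the recursive construction of `stableSet` well founded. -/
theorem sat_congr_of_knowDepth {U : Type*} [L.Structure U] {Γ Γ' : Set (MFormula L)}
    (φ : MFormula L) (h : ∀ ψ : MFormula L, ψ.knowDepth < φ.knowDepth → (ψ ∈ Γ ↔ ψ ∈ Γ'))
    (B : ℕ → U) : Sat Γ φ B ↔ Sat Γ' φ B := by
  induction φ generalizing B with
  | equal _ _ => rfl
  | rel _ _ => rfl
  | neg φ ih => exact not_congr (ih h B)
  | conj φ ψ ihφ ihψ =>
    exact and_congr (ihφ (fun χ hχ => h χ (lt_max_of_lt_left hχ)) B)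
      (ihψ (fun χ hχ => h χ (lt_max_of_lt_right hχ)) B)
  | ex x φ ih => exact exists_congr fun k => ih h _
  | know φ ih =>
    refine exists_congr fun β => and_congr_right fun _ => and_congr_right fun _ => h _ ?_
    rw [MFormula.knowDepth_applySubst]
    exact Nat.lt_succ_self _

/-- The only beliefs consulted are closed instances of atoms, which are ground atoms. -/
theorem sat_oga {U : Type*} [L.Structure U] (Γ : Set (MFormula L)) {φ : MFormula L}
    (h : φ.KnowsAtoms) (B : ℕ → U) : Sat (oga Γ) φ B ↔ Sat Γ φ B := by
  induction φ generalizing B with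
  | equal _ _ => rfl
  | rel _ _ => rfl
  | neg φ ih => exact not_congr (ih h B)
  | conj φ ψ ihφ ihψ => exact and_congr (ihφ h.1 B) (ihψ h.2 B)
  | ex x φ ih => exact exists_congr fun k => ih h _
  | know φ ih =>
    exact exists_congr fun β => and_congr_right fun _ => and_congr_right fun hc =>
      ⟨fun hm => hm.1, fun hm => ⟨hm, MFormula.IsAtomic.applySubst h β, hc⟩⟩

/-- The sentences of modal depth below `n` in the stable set generated by `𝒦`. -/
def stableStage (𝒦 : Set (Interp L)) : ℕ → Set (MFormula L)
  | 0 => ∅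
  | n + 1 => {φ | φ.Closed ∧ φ.knowDepth ≤ n ∧
      ∀ N ∈ 𝒦, IsModel (stableStage 𝒦 n) N.carrier φ}

theorem mem_stableStage_congr (𝒦 : Set (Interp L)) {m n : ℕ} (hmn : m ≤ n) {φ : MFormula L}
    (hφ : φ.knowDepth < m) : φ ∈ stableStage 𝒦 m ↔ φ ∈ stableStage 𝒦 n := by
  induction m generalizing n φ with
  | zero => simp at hφ
  | succ k ih =>
    obtain ⟨j, rfl⟩ : ∃ j, n = j + 1 := ⟨n - 1, by omega⟩
    refine and_congr_right fun _ => and_congr (by constructor <;> omega) ?_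
    refine forall_congr' fun N => forall_congr' fun _ => forall_congr' fun B =>
      sat_congr_of_knowDepth φ (fun ψ hψ => ih (by omega) (by omega)) B

/-- The stable set generated by a class of interpretations. -/
def stableSet (𝒦 : Set (Interp L)) : Set (MFormula L) :=
  {φ | φ ∈ stableStage 𝒦 (φ.knowDepth + 1)}

/-- The fixed-point equation: each stage evaluates `𝖫` with the previous one, and stages agree on
the depths they have already settled, so all of them can be replaced by the limit. -/
theorem mem_stableSet_iff (𝒦 : Set (Interp L)) (φ : MFormula L) :
    φ ∈ stableSet 𝒦 ↔ φ.Closed ∧ ∀ N ∈ 𝒦, IsModel (stableSet 𝒦) N.carrier φ := by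
  refine and_congr_right fun _ => (and_iff_right le_rfl).trans ?_
  exact forall_congr' fun N => forall_congr' fun _ => forall_congr' fun B =>
    sat_congr_of_knowDepth φ (fun ψ hψ => (mem_stableStage_congr 𝒦 hψ (Nat.lt_succ_self _)).symm) B

/-! ### Reduction of stable expansions to their ground atoms -/

/-- `S` is the set of the ground atoms that `Δ` entails with respect to the belief set `S`. -/
def IsAtomicExpansion (Δ S : Set (MFormula L)) : Prop :=
  S = {φ | φ.IsGroundAtom ∧ ∀ N ∈ models Δ S, φ ∈ N.truths}

theorem models_oga {Δ : Set (MFormula L)} (hΔ : ∀ φ ∈ Δ, φ.KnowsAtoms) (Γ : Set (MFormula L)) :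
    models Δ (oga Γ) = models Δ Γ := by
  ext N
  exact forall_congr' fun φ => forall_congr' fun hφ => forall_congr' fun B => sat_oga Γ (hΔ φ hφ) B

theorem IsStableExpansion.isAtomicExpansion {Δ T : Set (MFormula L)}
    (hΔ : ∀ φ ∈ Δ, φ.KnowsAtoms) (hT : IsStableExpansion Δ T) : IsAtomicExpansion Δ (oga T) := by
  ext φ
  rw [models_oga hΔ]
  have key : φ ∈ T ↔ φ.Closed ∧ ∀ N ∈ models Δ T, IsModel T N.carrier φ := by
    rw [← entails_iff]
    exact Set.ext_iff.1 hT φ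
  constructor
  · rintro ⟨h, hg⟩
    exact ⟨hg, fun N hN => (N.mem_truths_iff_isModel hg T).2 ((key.1 h).2 N hN)⟩
  · rintro ⟨hg, h⟩
    exact ⟨key.2 ⟨hg.2, fun N hN => (N.mem_truths_iff_isModel hg T).1 (h N hN)⟩, hg⟩

/-- The expansion is the stable set generated by the models of `Δ` with respect to `S`. -/
theorem IsAtomicExpansion.exists_isStableExpansion {Δ S : Set (MFormula L)}
    (hΔ : ∀ φ ∈ Δ, φ.KnowsAtoms) (hS : IsAtomicExpansion Δ S) :
    ∃ T, IsStableExpansion Δ T ∧ S = oga T := by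
  have hST : S = oga (stableSet (models Δ S)) := by
    ext φ
    rw [Set.ext_iff.1 hS φ]
    constructor
    · rintro ⟨hg, h⟩
      exact ⟨(mem_stableSet_iff _ _).2
        ⟨hg.2, fun N hN => (N.mem_truths_iff_isModel hg _).1 (h N hN)⟩, hg⟩
    · rintro ⟨h, hg⟩
      exact ⟨hg, fun N hN => (N.mem_truths_iff_isModel hg _).2 (((mem_stableSet_iff _ _).1 h).2 N hN)⟩
  refine ⟨_, ?_, hST⟩
  -- Beliefs beyond the ground atoms do not affect which interpretations are models, so the
  -- fixed-point equation of `stableSet` becomes that of a stable expansion.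
  have hm : models Δ (stableSet (models Δ S)) = models Δ S := by
    conv_rhs => rw [hST]
    rw [models_oga hΔ]
  refine Set.ext fun φ => ?_
  rw [mem_stableSet_iff]
  change _ ↔ _ ∧ _
  rw [entails_iff, hm]

theorem equivOga_of_isAtomicExpansion_iff {Δ₁ Δ₂ : Set (MFormula L)}
    (h₁ : ∀ φ ∈ Δ₁, φ.KnowsAtoms) (h₂ : ∀ φ ∈ Δ₂, φ.KnowsAtoms)
    (h : ∀ S, IsAtomicExpansion Δ₁ S ↔ IsAtomicExpansion Δ₂ S) : EquivOga Δ₁ Δ₂ :=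
  ⟨fun _ hT => ((h _).1 (hT.isAtomicExpansion h₁)).exists_isStableExpansion h₂,
    fun _ hT =>
      let ⟨T, hT', hTe⟩ := ((h _).2 (hT.isAtomicExpansion h₂)).exists_isStableExpansion h₁
      ⟨T, hT', hTe.symm⟩⟩

/-! ### Products of interpretations -/

/-- The direct product of a family of interpretations. -/
def Interp.prod {I : Type (max u v)} (N : I → Interp L) : Interp L where
  carrier := ∀ i, (N i).carrier
  str :=
    { funMap := fun f xs i => Structure.funMap f fun j => xs j i
      RelMap := fun R xs => ∀ i, Structure.RelMap R fun j => xs j i }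

section Product

variable {I : Type (max u v)} (N : I → Interp L)

theorem realize_prod {α : Type*} (t : L.Term α) (B : α → (Interp.prod N).carrier) (i : I) :
    t.realize B i = t.realize fun x => B x i := by
  induction t with
  | var x => rfl
  | func f ts ih =>
    simp only [FirstOrder.Language.Term.realize_func]
    rw [← funext ih]
    rfl

theorem sat_prod_of_isAtomic {Γ : Set (MFormula L)} {φ : MFormula L} (hφ : φ.IsAtomic)
    (B : ℕ → (Interp.prod N).carrier) : Sat Γ φ B ↔ ∀ i, Sat Γ φ fun x => B x i := by
  cases φ with
  | equal t₁ t₂ =>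
    simp only [Sat, ← realize_prod]
    exact funext_iff
  | rel R ts =>
    simp only [Sat, ← realize_prod]
    exact Iff.rfl
  | _ => exact hφ.elim

theorem sat_prod_exList {Γ : Set (MFormula L)} {φ : MFormula L} (hφ : φ.IsAtomic) (ys : List ℕ)
    (B : ℕ → (Interp.prod N).carrier) :
    Sat Γ (MFormula.exList ys φ) B ↔ ∀ i, Sat Γ (MFormula.exList ys φ) fun x => B x i := by
  induction ys generalizing B with
  | nil => exact sat_prod_of_isAtomic N hφ B
  | cons y ys ih =>
    have hu : ∀ (k : (Interp.prod N).carrier) (i : I),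
        (fun x => Function.update B y k x i) = Function.update (fun x => B x i) y (k i) := by
      intro k i
      funext x
      by_cases hx : x = y
      · subst hx; simp
      · simp [hx]
    change (∃ k, Sat Γ (MFormula.exList ys φ) (Function.update B y k)) ↔
      ∀ i, ∃ k, Sat Γ (MFormula.exList ys φ) (Function.update (fun x => B x i) y k)
    constructor
    · rintro ⟨k, hk⟩ i
      exact ⟨k i, by rw [← hu]; exact (ih _).1 hk i⟩
    · intro h
      choose k hk using h
      -- Witnesses chosen in each factor assemble into one witness in the product.
      exact ⟨k, (ih _).2 fun i => (congrArg _ (hu k i)).mpr (hk i)⟩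

theorem mem_truths_prod {φ : MFormula L} : φ ∈ (Interp.prod N).truths ↔
    φ.IsGroundAtom ∧ ∀ i, φ ∈ (N i).truths := by
  by_cases hφ : φ.IsGroundAtom
  · rw [Interp.mem_truths_iff hφ ∅ fun _ => Classical.arbitrary _, sat_prod_of_isAtomic N hφ.1,
      and_iff_right hφ]
    exact forall_congr' fun i => (Interp.mem_truths_iff hφ ∅ _).symm
  · exact ⟨fun h => (hφ h.1).elim, fun h => (hφ h.1).elim⟩

end Product

/-- An atomic expansion `S` of `Δ₁` is one of `Δ₂` if the models whose ground atoms lie in `S` are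
closed under products and can be transferred in both directions with the same ground atoms. -/
theorem IsAtomicExpansion.transfer {Δ₁ Δ₂ S : Set (MFormula L)}
    (hprod₁ : ∀ (I : Type (max u v)) [Nonempty I] (N : I → Interp L), (∀ i, N i ∈ models Δ₁ S) →
      (Interp.prod N).truths ⊆ S → Interp.prod N ∈ models Δ₁ S)
    (hprod₂ : ∀ (I : Type (max u v)) [Nonempty I] (N : I → Interp L), (∀ i, N i ∈ models Δ₂ S) →
      (Interp.prod N).truths ⊆ S → Interp.prod N ∈ models Δ₂ S)
    (h₁₂ : ∀ N ∈ models Δ₁ S, N.truths ⊆ S → ∃ K ∈ models Δ₂ S, K.truths = N.truths)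
    (h₂₁ : ∀ N ∈ models Δ₂ S, N.truths ⊆ S → ∃ K ∈ models Δ₁ S, K.truths = N.truths)
    (hS : IsAtomicExpansion Δ₁ S) : IsAtomicExpansion Δ₂ S := by
  have hmem := Set.ext_iff.1 hS
  have hground : ∀ φ ∈ S, φ.IsGroundAtom := fun φ hφ => ((hmem φ).1 hφ).1
  rcases (models Δ₁ S).eq_empty_or_nonempty with hempty | ⟨N₀, hN₀⟩
  -- With no models of `Δ₁`, `S` consists of all ground atoms, so any model of `Δ₂` could be
  -- transferred to one of `Δ₁`; thus `Δ₂` has no models either.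
  · have hall : ∀ φ : MFormula L, φ.IsGroundAtom → φ ∈ S := fun φ hφ =>
      (hmem φ).2 ⟨hφ, fun N hN => by simp [hempty] at hN⟩
    refine Set.ext fun φ => ⟨fun hφ => ⟨hground φ hφ, fun N hN => ?_⟩, fun hφ => hall φ hφ.1⟩
    obtain ⟨K, hK, -⟩ := h₂₁ N hN fun ψ hψ => hall ψ hψ.1
    simp [hempty] at hK
  · have hcounter : ∀ φ : {φ : MFormula L // φ.IsGroundAtom ∧ φ ∉ S},
        ∃ N ∈ models Δ₁ S, φ.1 ∉ N.truths := by
      rintro ⟨φ, hg, hφ⟩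
      by_contra hcon
      push Not at hcon
      exact hφ ((hmem φ).2 ⟨hg, hcon⟩)
    choose C hC hCφ using hcounter
    -- One countermodel for each ground atom outside `S`; their product makes no such atom true. The
    -- extra factor `N₀` keeps the index type nonempty when `S` contains all ground atoms.
    let fam : Option {φ : MFormula L // φ.IsGroundAtom ∧ φ ∉ S} → Interp L := fun o => o.elim N₀ C
    have hfam : ∀ o, fam o ∈ models Δ₁ S := by rintro (_ | φ) <;> [exact hN₀; exact hC φ]
    have hsub : (Interp.prod fam).truths ⊆ S := by
      intro φ hφ
      rw [mem_truths_prod] at hφ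
      by_contra hφS
      exact hCφ ⟨φ, hφ.1, hφS⟩ (hφ.2 (some ⟨φ, hφ.1, hφS⟩))
    obtain ⟨M, hM, hMt⟩ := h₁₂ _ (hprod₁ _ fam hfam hsub) hsub
    rw [← hMt] at hsub
    refine Set.ext fun φ => ⟨fun hφ => ⟨hground φ hφ, fun N hN => ?_⟩, fun hφ => hsub (hφ.2 M hM)⟩
    -- Multiplying an arbitrary model `N` of `Δ₂` by `M` brings its ground atoms into `S`. The
    -- transferred model of `Δ₁` then makes all of `S` true, and hence so does the factor `N`.
    let pair : ULift.{max u v} Bool → Interp L := fun b => if b.down then N else M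
    have hpsub : (Interp.prod pair).truths ⊆ S := fun ψ hψ =>
      hsub (((mem_truths_prod pair).1 hψ).2 ⟨false⟩)
    have hpair : ∀ b, pair b ∈ models Δ₂ S := by
      rintro ⟨_ | _⟩ <;> [exact hM; exact hN]
    obtain ⟨K, hK, hKt⟩ := h₂₁ _ (hprod₂ _ pair hpair hpsub) hpsub
    have hφK := ((hmem φ).1 hφ).2 K hK
    rw [hKt] at hφK
    exact ((mem_truths_prod pair).1 hφK).2 ⟨true⟩

/-! ### Satisfaction of closures and implications -/

section Connectives

variable {Γ : Set (MFormula L)} {U : Type*} [L.Structure U]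

theorem sat_all {x : ℕ} {φ : MFormula L} {B : ℕ → U} :
    Sat Γ (.all x φ) B ↔ ∀ k, Sat Γ φ (Function.update B x k) := by
  simp [MFormula.all, Sat]

theorem isModel_closure {φ : MFormula L} : IsModel Γ U φ.closure ↔ IsModel Γ U φ := by
  have key : ∀ l : List ℕ, IsModel Γ U (l.foldr MFormula.all φ) ↔ IsModel Γ U φ := by
    intro l
    induction l with
    | nil => rfl
    | cons x l ih =>
      rw [← ih]
      refine ⟨fun h B => ?_, fun h B => sat_all.2 fun k => h _⟩
      have := sat_all.1 (h B) (B x)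
      rwa [Function.update_eq_self] at this
  exact key _

theorem sat_foldl_conj {φ : MFormula L} {φs : List (MFormula L)} {B : ℕ → U} :
    Sat Γ (φs.foldl .conj φ) B ↔ Sat Γ φ B ∧ ∀ ψ ∈ φs, Sat Γ ψ B := by
  induction φs generalizing φ with
  | nil => simp
  | cons ψ φs ih => simp [ih, Sat, and_assoc]

theorem sat_impList {φs : List (MFormula L)} {ψ : MFormula L} {B : ℕ → U} :
    Sat Γ (.impList φs ψ) B ↔ ((∀ φ ∈ φs, Sat Γ φ B) → Sat Γ ψ B) := by
  cases φs with
  | nil => simp [MFormula.impList]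
  | cons φ φs =>
    simp only [MFormula.impList, MFormula.imp, MFormula.disj, Sat, sat_foldl_conj,
      List.forall_mem_cons]
    tauto

theorem not_sat_falsum {B : ℕ → U} : ¬ Sat Γ .falsum B := by
  simp [MFormula.falsum, Sat]

end Connectives

/-! ### The embedded formulas apply the modal operator to atoms only -/

theorem MFormula.knowsAtoms_closure {φ : MFormula L} (h : φ.KnowsAtoms) : φ.closure.KnowsAtoms := by
  have key : ∀ l : List ℕ, (l.foldr MFormula.all φ).KnowsAtoms := by
    intro l
    induction l with
    | nil => exact h
    | cons x l ih => exact ih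
  exact key _

theorem MFormula.knowsAtoms_impList {φs : List (MFormula L)} {ψ : MFormula L}
    (hφs : ∀ φ ∈ φs, φ.KnowsAtoms) (hψ : ψ.KnowsAtoms) : (impList φs ψ).KnowsAtoms := by
  cases φs with
  | nil => exact hψ
  | cons φ φs =>
    refine ⟨?_, hψ⟩
    rw [List.forall_mem_cons] at hφs
    obtain ⟨h, hs⟩ := hφs
    change (φs.foldl MFormula.conj φ).KnowsAtoms
    clear hψ
    induction φs generalizing φ with
    | nil => exact h
    | cons χ φs ih =>
      rw [List.forall_mem_cons] at hs
      exact ih _ ⟨h, hs.1⟩ hs.2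

theorem MFormula.knowsAtoms_exList {φ : MFormula L} (h : φ.KnowsAtoms) (ys : List ℕ) :
    (exList ys φ).KnowsAtoms := by
  induction ys with
  | nil => exact h
  | cons y ys ih => exact ih

theorem IsGHorn.knowsAtoms {φ : MFormula L} (h : IsGHorn φ) : φ.KnowsAtoms := by
  obtain ⟨body, hb, ⟨h, ys, hh, -, rfl⟩ | rfl⟩ := h
  · exact MFormula.knowsAtoms_closure (MFormula.knowsAtoms_impList (fun b hb' => (hb b hb').knowsAtoms)
      (MFormula.knowsAtoms_exList hh.knowsAtoms ys))
  · exact MFormula.knowsAtoms_closure (MFormula.knowsAtoms_impList (fun b hb' => (hb b hb').knowsAtoms)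
      trivial)

theorem knowsAtoms_embedRule (χ : Emb) (r : Rule L) : (embedRule χ r).KnowsAtoms := by
  refine MFormula.knowsAtoms_closure (MFormula.knowsAtoms_impList ?_ ?_)
  · intro φ hφ
    rw [List.mem_append, List.mem_map, List.mem_map] at hφ
    obtain ⟨b, -, rfl⟩ | ⟨c, -, rfl⟩ := hφ
    · cases χ <;> simp [embedPos, Atom.toFormula, MFormula.KnowsAtoms, MFormula.IsAtomic]
    · trivial
  · cases χ <;> simp [embedHead, Atom.toFormula, MFormula.KnowsAtoms, MFormula.IsAtomic]

theorem knowsAtoms_combine {χ : Emb} {Φ : Set (MFormula L)} {P : Program L} (hΦ : GHornTheory Φ) :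
    ∀ φ ∈ combine χ Φ P, φ.KnowsAtoms := by
  rintro φ (hφ | ⟨r, -, rfl⟩ | ⟨t₁, t₂, -, -, -, rfl⟩)
  · exact (hΦ φ hφ).knowsAtoms
  · exact knowsAtoms_embedRule χ r
  · simp [MFormula.imp, MFormula.disj, MFormula.KnowsAtoms, MFormula.IsAtomic]

theorem mem_models_combine {χ : Emb} {Φ : Set (MFormula L)} {P : Program L} {S : Set (MFormula L)}
    {N : Interp L} : N ∈ models (combine χ Φ P) S ↔
      (∀ φ ∈ Φ, IsModel S N.carrier φ) ∧ (∀ r ∈ P.rules, IsModel S N.carrier (embedRule χ r)) ∧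
        ∀ φ ∈ UNA P.fns, IsModel S N.carrier φ := by
  simp only [models, combine, embed, Set.mem_ofPred_eq, Set.mem_union, Set.mem_image, or_imp,
    forall_and, forall_exists_index, and_imp, forall_apply_eq_imp_iff₂]

/-! ### Named individuals and name substitutions -/

/-- `a` is the denotation of a name. -/
def Named (L : FirstOrder.Language.{u, v}) {U : Type*} [L.Structure U] (a : U) : Prop :=
  ∃ t : Name L, t.realize (Empty.elim : Empty → U) = a

section Names

variable {U : Type*} [L.Structure U]

theorem Named.funMap {n : ℕ} (f : L.Functions n) {xs : Fin n → U} (h : ∀ i, Named L (xs i)) :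
    Named L (Structure.funMap f xs) := by
  choose t ht using h
  exact ⟨.func f t, by simp only [FirstOrder.Language.Term.realize_func, ht]⟩

theorem named_realize (t : L.Term ℕ) {B : ℕ → U} (h : ∀ x ∈ t.varFinset, Named L (B x)) :
    Named L (t.realize B) := by
  induction t with
  | var x => exact h x (by simp [FirstOrder.Language.Term.varFinset])
  | func f ts ih =>
    refine Named.funMap f fun i => ih i fun x hx => h x ?_
    simp only [FirstOrder.Language.Term.varFinset, Finset.mem_biUnion, Finset.mem_univ, true_and]
    exact ⟨i, hx⟩

theorem exists_associated (B : ℕ → U) : ∃ β : NameSubst L, Associated B β := by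
  classical
  refine ⟨fun x => if h : Named L (B x) then some h.choose else none, fun x => ?_⟩
  by_cases h : Named L (B x)
  · simp only [h, dite_true]
    exact h.choose_spec
  · simp only [h, dite_false]
    exact h

theorem Associated.realize_eq {B : ℕ → U} {β : NameSubst L} (h : Associated B β) {x : ℕ}
    {t : Name L} (hx : β x = some t) : t.realize (Empty.elim : Empty → U) = B x := by
  have := h x
  rwa [hx] at this

theorem Associated.exists_eq_some {B : ℕ → U} {β : NameSubst L} (h : Associated B β) {x : ℕ}
    (hx : Named L (B x)) : ∃ t, β x = some t := by
  have := h x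
  cases hβ : β x with
  | some t => exact ⟨t, rfl⟩
  | none =>
    rw [hβ] at this
    exact (this hx).elim

theorem realize_toTerm (t : Name L) (B : ℕ → U) :
    t.toTerm.realize B = t.realize (Empty.elim : Empty → U) := by
  rw [Name.toTerm, FirstOrder.Language.Term.realize_relabel]
  congr 1
  funext x
  exact x.elim

/-- The assignment `B`, changed to the denotation of `β x` at each `x` in the domain of `β`. -/
def NameSubst.assign (β : NameSubst L) (B : ℕ → U) (x : ℕ) : U :=
  (β x).elim (B x) fun t => t.realize (Empty.elim : Empty → U)

theorem realize_substTerm (β : NameSubst L) (t : L.Term ℕ) (B : ℕ → U) :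
    (substTerm β t).realize B = t.realize (β.assign B) := by
  rw [substTerm, FirstOrder.Language.Term.realize_subst]
  congr 1
  funext x
  cases h : β x with
  | none => simp [NameSubst.assign, h]
  | some s => simp [NameSubst.assign, h, realize_toTerm]

theorem Associated.assign_eq {B : ℕ → U} {β : NameSubst L} (h : Associated B β) :
    β.assign B = B := by
  funext x
  cases hx : β x with
  | none => simp [NameSubst.assign, hx]
  | some s => simp [NameSubst.assign, hx, h.realize_eq hx]

theorem sat_applySubst {Γ Γ' : Set (MFormula L)} {φ : MFormula L} (hφ : φ.IsAtomic)
    (β : NameSubst L) (B : ℕ → U) : Sat Γ (φ.applySubst β) B ↔ Sat Γ' φ (β.assign B) := by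
  cases φ with
  | equal t₁ t₂ => simp only [MFormula.applySubst, Sat, realize_substTerm]
  | rel R ts => simp only [MFormula.applySubst, Sat, realize_substTerm]
  | _ => exact hφ.elim

end Names

theorem varFinset_toTerm (t : Name L) : t.toTerm.varFinset = ∅ := by
  rw [Name.toTerm]
  induction t with
  | var x => exact x.elim
  | func f ts ih =>
    rw [FirstOrder.Language.Term.relabel, FirstOrder.Language.Term.varFinset]
    exact Finset.eq_empty_of_forall_notMem fun x hx => by simp [ih] at hx

theorem mem_varFinset_substTerm {β : NameSubst L} {t : L.Term ℕ} {x : ℕ} :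
    x ∈ (substTerm β t).varFinset ↔ x ∈ t.varFinset ∧ β x = none := by
  rw [substTerm]
  induction t with
  | var y =>
    cases h : β y with
    | none =>
      simp only [FirstOrder.Language.Term.subst, h, Option.elim, FirstOrder.Language.Term.varFinset,
        Finset.mem_singleton]
      constructor
      · rintro rfl; exact ⟨rfl, h⟩
      · exact And.left
    | some s =>
      simp only [FirstOrder.Language.Term.subst, h, Option.elim, varFinset_toTerm,
        FirstOrder.Language.Term.varFinset, Finset.mem_singleton, Finset.notMem_empty, false_iff]
      rintro ⟨rfl, h'⟩
      simp [h] at h'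
  | func f ts ih =>
    simp only [FirstOrder.Language.Term.subst, FirstOrder.Language.Term.varFinset,
      Finset.mem_biUnion, Finset.mem_univ, true_and, ih, exists_and_right]

theorem mem_freeVars_applySubst {β : NameSubst L} {φ : MFormula L} (hφ : φ.IsAtomic) {x : ℕ} :
    x ∈ (φ.applySubst β).freeVars ↔ x ∈ φ.freeVars ∧ β x = none := by
  cases φ with
  | equal t₁ t₂ =>
    simp only [MFormula.applySubst, MFormula.freeVars, Finset.mem_union, mem_varFinset_substTerm,
      or_and_right]
  | rel R ts =>
    simp only [MFormula.applySubst, MFormula.freeVars, Finset.mem_biUnion, Finset.mem_univ, true_and,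
      mem_varFinset_substTerm, exists_and_right]
  | _ => exact hφ.elim

theorem substTerm_congr (t : L.Term ℕ) {β β' : NameSubst L} (h : ∀ x ∈ t.varFinset, β x = β' x) :
    substTerm β t = substTerm β' t := by
  rw [substTerm, substTerm]
  induction t with
  | var x => simp [FirstOrder.Language.Term.subst, h x (by simp [FirstOrder.Language.Term.varFinset])]
  | func f ts ih =>
    simp only [FirstOrder.Language.Term.subst, FirstOrder.Language.Term.func.injEq, heq_eq_eq,
      true_and]
    funext i
    refine ih i fun x hx => h x ?_
    simp only [FirstOrder.Language.Term.varFinset, Finset.mem_biUnion, Finset.mem_univ, true_and]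
    exact ⟨i, hx⟩

theorem MFormula.IsAtomic.applySubst_congr {φ : MFormula L} (hφ : φ.IsAtomic) {β β' : NameSubst L}
    (h : ∀ x ∈ φ.freeVars, β x = β' x) : φ.applySubst β = φ.applySubst β' := by
  cases φ with
  | equal t₁ t₂ =>
    simp only [MFormula.applySubst]
    rw [substTerm_congr t₁ fun x hx => h x (by simp [MFormula.freeVars, hx]),
      substTerm_congr t₂ fun x hx => h x (by simp [MFormula.freeVars, hx])]
  | rel R ts =>
    simp only [MFormula.applySubst, MFormula.rel.injEq, heq_eq_eq, true_and]
    funext i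
    refine substTerm_congr _ fun x hx => h x ?_
    simp only [MFormula.freeVars, Finset.mem_biUnion, Finset.mem_univ, true_and]
    exact ⟨i, hx⟩
  | _ => exact hφ.elim

/-! ### Knowledge of atoms -/

/-- A variable with an unnamed value stays free under an associated substitution, so the instance
would not be closed. -/
theorem Sat.named_of_know {U : Type*} [L.Structure U] {S : Set (MFormula L)} {φ : MFormula L}
    (hφ : φ.IsAtomic) {B : ℕ → U} (h : Sat S φ.know B) {x : ℕ} (hx : x ∈ φ.freeVars) :
    Named L (B x) := by
  obtain ⟨β, hβ, hc, -⟩ := h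
  cases hβx : β x with
  | some t => exact ⟨t, hβ.realize_eq hβx⟩
  | none =>
    have := (mem_freeVars_applySubst hφ).2 ⟨hx, hβx⟩
    rw [hc] at this
    simp at this

theorem Interp.sat_know_of_sat {N : Interp L} {S : Set (MFormula L)} (hS : N.truths ⊆ S)
    {φ : MFormula L} (hφ : φ.IsAtomic) {B : ℕ → N.carrier} (hB : ∀ x ∈ φ.freeVars, Named L (B x))
    (h : Sat S φ B) : Sat S φ.know B := by
  obtain ⟨β, hβ⟩ := exists_associated (L := L) B
  have hc : (φ.applySubst β).Closed := by
    refine Finset.eq_empty_of_forall_notMem fun x hx => ?_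
    rw [mem_freeVars_applySubst hφ] at hx
    obtain ⟨t, ht⟩ := hβ.exists_eq_some (hB x hx.1)
    simp [ht] at hx
  refine ⟨β, hβ, hc, hS ?_⟩
  rw [Interp.mem_truths_iff ⟨hφ.applySubst β, hc⟩ S B, sat_applySubst hφ, hβ.assign_eq]
  exact h

/-- A name of an individual of the product also names each of its coordinates, so the same closed
instance serves in every factor. Only this direction is needed. -/
theorem sat_know_prod {I : Type (max u v)} {N : I → Interp L} {S : Set (MFormula L)}
    {φ : MFormula L} (hφ : φ.IsAtomic) {B : ℕ → (Interp.prod N).carrier} (h : Sat S φ.know B)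
    (i : I) : Sat S φ.know fun x => B x i := by
  obtain ⟨β, hβ, hc, hm⟩ := h
  obtain ⟨β₀, hβ₀⟩ := exists_associated (L := L) fun x => B x i
  have hdom : ∀ x ∈ φ.freeVars, β x ≠ none := fun x hx hn => by
    have := (mem_freeVars_applySubst hφ).2 ⟨hx, hn⟩
    rw [hc] at this
    simp at this
  -- A coordinate may be named although the tuple is not, so `β` has to be extended by `β₀`; this
  -- happens only at variables that are not free in `φ`.
  have hassoc : Associated (fun x => B x i) fun x => (β x).orElse fun _ => β₀ x := by
    intro x
    beta_reduce
    cases hx : β x with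
    | none => exact hβ₀ x
    | some t =>
      change t.realize (Empty.elim : Empty → _) = B x i
      rw [← hβ.realize_eq hx, realize_prod]
      congr 1
      funext e
      exact e.elim
  have heq : φ.applySubst (fun x => (β x).orElse fun _ => β₀ x) = φ.applySubst β :=
    hφ.applySubst_congr fun x hx => by
      cases hx' : β x with
      | none => exact (hdom x hx hx').elim
      | some t => rfl
  exact ⟨_, hassoc, by rwa [heq], by rwa [heq]⟩

/-- If two names denote the same individual, their equation is a true ground atom and hence
believed, which falsifies the premise of the axiom. -/
theorem isModel_UNA {N : Interp L} {S : Set (MFormula L)} (hS : N.truths ⊆ S)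
    (F : Set (Σ n, L.Functions n)) : ∀ φ ∈ UNA F, IsModel S N.carrier φ := by
  rintro _ ⟨t₁, t₂, -, -, -, rfl⟩ B
  have := @Interp.sat_know_of_sat L N S hS (.equal t₁.toTerm t₂.toTerm) trivial B
    (fun x hx => by simp [MFormula.freeVars, varFinset_toTerm] at hx)
  simp only [MFormula.imp, MFormula.disj, Sat] at this ⊢
  rintro ⟨h₁, h₂⟩
  exact h₁ fun h => h (this (not_not.1 h₂))

/-! ### Embedded rules -/

theorem Atom.isAtomic_toFormula (a : Atom L) : a.toFormula.IsAtomic := trivial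

section Rules

variable {S : Set (MFormula L)} {χ : Emb}

theorem isModel_embedRule {U : Type*} [L.Structure U] {r : Rule L} (hr : r.IsPositive) :
    IsModel S U (embedRule χ r) ↔ ∀ B : ℕ → U,
      (∀ b ∈ r.pos, Sat S (embedPos χ b) B) → Sat S (embedHead χ r.head) B := by
  rw [embedRule, isModel_closure, show r.neg = [] from hr]
  refine forall_congr' fun B => ?_
  rw [sat_impList]
  simp

theorem Sat.of_embedPos {U : Type*} [L.Structure U] {a : Atom L} {B : ℕ → U}
    (h : Sat S (embedPos χ a) B) : Sat S a.toFormula B := by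
  cases χ <;> [exact h; exact h.1; exact h.1]

theorem Sat.of_embedHead {U : Type*} [L.Structure U] {a : Atom L} {B : ℕ → U}
    (h : Sat S (embedHead χ a) B) : Sat S a.toFormula B := by
  cases χ <;> [exact h; exact h; exact h.1]

theorem Interp.sat_embedPos {N : Interp L} (hS : N.truths ⊆ S) {a : Atom L} {B : ℕ → N.carrier}
    (hB : ∀ x ∈ a.vars, Named L (B x)) (h : Sat S a.toFormula B) : Sat S (embedPos χ a) B := by
  have hk := Interp.sat_know_of_sat hS a.isAtomic_toFormula hB h
  cases χ <;> [exact h; exact ⟨h, hk⟩; exact ⟨h, hk⟩]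

theorem Interp.sat_embedHead {N : Interp L} (hS : N.truths ⊆ S) {a : Atom L} {B : ℕ → N.carrier}
    (hB : ∀ x ∈ a.vars, Named L (B x)) (h : Sat S a.toFormula B) : Sat S (embedHead χ a) B := by
  have hk := Interp.sat_know_of_sat hS a.isAtomic_toFormula hB h
  cases χ <;> [exact h; exact h; exact ⟨h, hk⟩]

theorem Rule.hasVar_head {r : Rule L} {x : ℕ} (hx : x ∈ r.head.vars) : r.HasVar x :=
  ⟨r.head, by simp [Rule.atoms], hx⟩

theorem Rule.hasVar_pos {r : Rule L} {b : Atom L} (hb : b ∈ r.pos) {x : ℕ} (hx : x ∈ b.vars) :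
    r.HasVar x :=
  ⟨b, by simp [Rule.atoms, hb], hx⟩

/-- Epistemic rule bodies are true for named individuals only. -/
theorem Rule.IsSafe.named {U : Type*} [L.Structure U] {r : Rule L} (hr : r.IsSafe)
    (hχ : χ = .EB ∨ χ = .EH) {B : ℕ → U} (h : ∀ b ∈ r.pos, Sat S (embedPos χ b) B) {x : ℕ}
    (hx : r.HasVar x) : Named L (B x) := by
  obtain ⟨b, hb, hxb⟩ := hr x hx
  have hk : Sat S b.toFormula.know B := by
    rcases hχ with rfl | rfl <;> exact (h b hb).2
  exact hk.named_of_know b.isAtomic_toFormula hxb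

theorem isModel_prod_embedRule {I : Type (max u v)} [Nonempty I] {N : I → Interp L} {r : Rule L}
    (hpos : r.IsPositive) (hsafe : r.IsSafe) (hS : (Interp.prod N).truths ⊆ S)
    (hN : ∀ i, IsModel S (N i).carrier (embedRule χ r)) :
    IsModel S (Interp.prod N).carrier (embedRule χ r) := by
  simp only [isModel_embedRule hpos] at hN ⊢
  intro B hB
  have hcoord : ∀ i, ∀ b ∈ r.pos, Sat S (embedPos χ b) fun x => B x i := by
    intro i b hb
    have h := (sat_prod_of_isAtomic N b.isAtomic_toFormula B).1 (hB b hb).of_embedPos i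
    cases χ with
    | HP => exact h
    | EB => exact ⟨h, sat_know_prod b.isAtomic_toFormula (hB b hb).2 i⟩
    | EH => exact ⟨h, sat_know_prod b.isAtomic_toFormula (hB b hb).2 i⟩
  have hhead : Sat S r.head.toFormula B := (sat_prod_of_isAtomic N r.head.isAtomic_toFormula B).2
    fun i => (hN i _ (hcoord i)).of_embedHead
  cases χ with
  | HP => exact hhead
  | EB => exact hhead
  -- Knowledge does not lift from the factors to the product. Instead `𝖫 h` follows from the truth
  -- of `h` in the product, whose true ground atoms are believed.
  | EH =>
    exact Interp.sat_embedHead (N := Interp.prod N) hS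
      (fun x hx => hsafe.named (.inr rfl) hB (Rule.hasVar_head hx)) hhead

theorem Rule.hasVar_applySubst {r : Rule L} {β : NameSubst L} {x : ℕ} :
    (r.applySubst β).HasVar x ↔ r.HasVar x ∧ β x = none := by
  have hatoms : (r.applySubst β).atoms = r.atoms.map (Atom.applySubst β) := by
    simp [Rule.atoms, Rule.applySubst]
  have hvars : ∀ a : Atom L, x ∈ (a.applySubst β).vars ↔ x ∈ a.vars ∧ β x = none := fun a =>
    mem_freeVars_applySubst a.isAtomic_toFormula
  simp only [Rule.HasVar, hatoms, List.mem_map, exists_exists_and_eq_and, hvars, ← and_assoc,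
    exists_and_right]

theorem Rule.IsPositive.applySubst {r : Rule L} (hr : r.IsPositive) (β : NameSubst L) :
    (r.applySubst β).IsPositive := by
  have : r.neg = [] := hr
  simp [Rule.IsPositive, Rule.applySubst, this]

theorem Rule.IsGround.isSafe {r : Rule L} (hr : r.IsGround) : r.IsSafe := fun x hx => (hr x hx).elim

/-- A model of a rule that knows its ground atoms is a model of the ground instances of the rule. -/
theorem isModel_ground_instance {N : Interp L} (hS : N.truths ⊆ S) {r : Rule L}
    (hpos : r.IsPositive) (hN : IsModel S N.carrier (embedRule χ r)) {β : NameSubst L}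
    (hβ : (r.applySubst β).IsGround) : IsModel S N.carrier (embedRule χ (r.applySubst β)) := by
  rw [isModel_embedRule hpos] at hN
  rw [isModel_embedRule (hpos.applySubst β)]
  intro B hB
  have hnamed : ∀ x, r.HasVar x → Named L (β.assign B x) := by
    intro x hx
    cases h : β x with
    | none => exact (hβ x (Rule.hasVar_applySubst.2 ⟨hx, h⟩)).elim
    | some t => exact ⟨t, by simp [NameSubst.assign, h]⟩
  refine Interp.sat_embedHead hS (fun x hx => (hβ x (Rule.hasVar_head hx)).elim) ?_
  refine (sat_applySubst (Γ' := S) r.head.isAtomic_toFormula β B).2 (hN (β.assign B) ?_).of_embedHead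
  intro b hb
  -- Any conjunct `𝖫 b` is recovered from the truth of `b` for named values, which avoids comparing
  -- the substitutions involved.
  refine Interp.sat_embedPos hS (fun x hx => hnamed x (Rule.hasVar_pos hb hx)) ?_
  exact (sat_applySubst b.isAtomic_toFormula β B).1
    (hB (b.applySubst β) (List.mem_map_of_mem hb)).of_embedPos

/-- A rule whose ground instances are satisfied holds for all assignments of named individuals. -/
theorem sat_embedHead_of_ground_instances {N : Interp L} (hS : N.truths ⊆ S) {r : Rule L}
    (hpos : r.IsPositive)
    (hN : ∀ β : NameSubst L, (r.applySubst β).IsGround →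
      IsModel S N.carrier (embedRule χ (r.applySubst β)))
    {B : ℕ → N.carrier} (hB : ∀ x, r.HasVar x → Named L (B x))
    (hbody : ∀ b ∈ r.pos, Sat S b.toFormula B) : Sat S (embedHead χ r.head) B := by
  obtain ⟨β, hβ⟩ := exists_associated (L := L) B
  have hg : (r.applySubst β).IsGround := by
    intro x hx
    rw [Rule.hasVar_applySubst] at hx
    obtain ⟨t, ht⟩ := hβ.exists_eq_some (hB x hx.1)
    simp [ht] at hx
  have hsat : ∀ a : Atom L, Sat S (a.applySubst β).toFormula B ↔ Sat S a.toFormula B := fun a => by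
    have := sat_applySubst (Γ := S) (Γ' := S) a.isAtomic_toFormula β B
    rwa [hβ.assign_eq] at this
  refine Interp.sat_embedHead hS (fun x hx => hB x (Rule.hasVar_head hx)) ((hsat _).1 ?_)
  refine Sat.of_embedHead ((isModel_embedRule (hpos.applySubst β)).1 (hN β hg) B ?_)
  intro b' hb'
  obtain ⟨b, hb, rfl⟩ := List.mem_map.1 hb'
  exact Interp.sat_embedPos hS (fun x hx => (hg x (Rule.hasVar_pos hb' hx)).elim)
    ((hsat b).2 (hbody b hb))

end Rules

/-! ### Generalized Horn theories and products -/

theorem IsHorn.isGHorn {φ : MFormula L} (h : IsHorn φ) : IsGHorn φ := by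
  obtain ⟨body, hb, ⟨h, hh, rfl⟩ | rfl⟩ := h
  · exact ⟨body, hb, .inl ⟨h, [], hh, by simp, rfl⟩⟩
  · exact ⟨body, hb, .inr rfl⟩

theorem IsGHorn.isModel_prod {I : Type (max u v)} [Nonempty I] {N : I → Interp L}
    {Γ : Set (MFormula L)} {φ : MFormula L} (hφ : IsGHorn φ)
    (hN : ∀ i, IsModel Γ (N i).carrier φ) : IsModel Γ (Interp.prod N).carrier φ := by
  obtain ⟨body, hb, ⟨h, ys, hh, -, rfl⟩ | rfl⟩ := hφ
  all_goals
    simp only [isModel_closure] at hN ⊢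
    intro B
    rw [sat_impList]
    intro hB
    have hbody : ∀ i, ∀ b ∈ body, Sat Γ b fun x => B x i := fun i b hb' =>
      (sat_prod_of_isAtomic N (hb b hb') B).1 (hB b hb') i
  · exact (sat_prod_exList N hh ys B).2 fun i => sat_impList.1 (hN i _) (hbody i)
  -- An empty product could violate a constraint; a nonempty one would carry the violation to a
  -- factor.
  · obtain ⟨i⟩ := ‹Nonempty I›
    exact (not_sat_falsum (sat_impList.1 (hN i _) (hbody i))).elim

theorem prod_mem_models_combine {χ : Emb} {Φ : Set (MFormula L)} {P : Program L}
    {S : Set (MFormula L)} (hΦ : GHornTheory Φ) (hpos : P.IsPositive) (hsafe : P.IsSafe)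
    {I : Type (max u v)} [Nonempty I] {N : I → Interp L}
    (hN : ∀ i, N i ∈ models (combine χ Φ P) S) (hS : (Interp.prod N).truths ⊆ S) :
    Interp.prod N ∈ models (combine χ Φ P) S := by
  simp only [mem_models_combine] at hN ⊢
  exact ⟨fun φ hφ => (hΦ φ hφ).isModel_prod fun i => (hN i).1 φ hφ,
    fun r hr => isModel_prod_embedRule (hpos r hr) (hsafe r hr) hS fun i => (hN i).2.1 r hr,
    isModel_UNA hS _⟩

/-! ### The substructure of the named individuals -/

/-- The substructure of the named individuals. -/
def namedSubstructure (L : FirstOrder.Language.{u, v}) (U : Type*) [L.Structure U] :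
    L.Substructure U where
  carrier := {a | Named L a}
  fun_mem := fun f _ h => Named.funMap f h

section NamedPart

variable {U : Type*} [L.Structure U]

theorem coe_realize_namedSubstructure {α : Type*} (t : L.Term α)
    (B : α → namedSubstructure L U) :
    ((t.realize B : namedSubstructure L U) : U) = t.realize fun x => (B x : U) := by
  induction t with
  | var x => rfl
  | func f ts ih =>
    simp only [FirstOrder.Language.Term.realize_func, ← ih]
    rfl

theorem named_namedSubstructure (a : namedSubstructure L U) : Named L a := by
  obtain ⟨t, ht⟩ := a.2
  refine ⟨t, Subtype.ext ?_⟩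
  rw [coe_realize_namedSubstructure, ← ht]
  congr 1
  funext e
  exact e.elim

theorem sat_namedSubstructure {Γ : Set (MFormula L)} {φ : MFormula L} (hφ : φ.IsAtomic)
    (B : ℕ → namedSubstructure L U) : Sat Γ φ B ↔ Sat Γ φ fun x => (B x : U) := by
  cases φ with
  | equal t₁ t₂ => simp only [Sat, ← coe_realize_namedSubstructure, Subtype.coe_inj]
  | rel R ts =>
    simp only [Sat, ← coe_realize_namedSubstructure]
    rfl
  | _ => exact hφ.elim

/-- Horn sentences are universal. An existential head could lose its witness here, which is why
generalized Horn theories need another construction. -/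
theorem IsHorn.isModel_namedSubstructure {Γ : Set (MFormula L)} {φ : MFormula L} (hφ : IsHorn φ)
    (h : IsModel Γ U φ) : IsModel Γ (namedSubstructure L U) φ := by
  obtain ⟨body, hb, ⟨a, ha, rfl⟩ | rfl⟩ := hφ
  all_goals
    rw [isModel_closure] at h ⊢
    intro B
    rw [sat_impList]
    intro hB
    have h' := sat_impList.1 (h fun x => (B x : U)) fun b hb' =>
      (sat_namedSubstructure (hb b hb') B).1 (hB b hb')
  · exact (sat_namedSubstructure ha B).2 h'
  · exact (not_sat_falsum h').elim

end NamedPart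

/-- The restriction of an interpretation to its named individuals. -/
def Interp.namedPart (N : Interp L) (t : Name L) : Interp L where
  carrier := namedSubstructure L N.carrier
  nonempty := ⟨⟨_, t, rfl⟩⟩

theorem Interp.truths_namedPart (N : Interp L) (t : Name L) : (N.namedPart t).truths = N.truths := by
  ext φ
  by_cases hφ : φ.IsGroundAtom
  · let B : ℕ → (N.namedPart t).carrier := fun _ => Classical.arbitrary _
    rw [Interp.mem_truths_iff hφ ∅ B, Interp.mem_truths_iff hφ ∅ fun x => (B x).1]
    exact sat_namedSubstructure hφ.1 B
  · exact ⟨fun h => (hφ h.1).elim, fun h => (hφ h.1).elim⟩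

/-! ### Restriction of predicates to named individuals -/

/-- The interpretation in which the predicates outside `p` are restricted to named individuals. -/
def Interp.restrictPreds (N : Interp L) (p : Set (Σ n, L.Relations n)) : Interp L where
  carrier := N.carrier
  str :=
    { funMap := fun f xs => N.str.funMap f xs
      RelMap := fun {n} R xs => N.str.RelMap R xs ∧
        ((⟨n, R⟩ : Σ n, L.Relations n) ∉ p → ∀ i, @Named L N.carrier N.str (xs i)) }

section RestrictPreds

variable (N : Interp L) (p : Set (Σ n, L.Relations n))

theorem realize_restrictPreds {α : Type*} (t : L.Term α) (B : α → N.carrier) :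
    @FirstOrder.Language.Term.realize L N.carrier (N.restrictPreds p).str α B t = t.realize B := by
  induction t with
  | var x => rfl
  | func f ts ih =>
    change N.str.funMap f _ = N.str.funMap f _
    congr 1
    funext i
    exact ih i

theorem associated_restrictPreds (B : ℕ → N.carrier) (β : NameSubst L) :
    @Associated L N.carrier (N.restrictPreds p).str B β ↔ Associated B β := by
  refine forall_congr' fun x => ?_
  cases β x with
  | some t => simp only [realize_restrictPreds]
  | none => simp only [realize_restrictPreds]

/-- Function symbols keep their interpretation, so the named individuals, and with them the meaning
of `𝖫`, are unchanged. -/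
theorem sat_restrictPreds {Γ : Set (MFormula L)} {φ : MFormula L} (hφ : φ.preds ⊆ p)
    (B : ℕ → N.carrier) :
    @Sat L Γ N.carrier (N.restrictPreds p).str φ B ↔ Sat Γ φ B := by
  induction φ generalizing B with
  | equal t₁ t₂ => simp only [Sat, realize_restrictPreds]
  | rel R ts =>
    simp only [Sat, realize_restrictPreds]
    exact and_iff_left fun h => (h (hφ rfl)).elim
  | neg φ ih => exact not_congr (ih hφ B)
  | conj φ ψ ihφ ihψ =>
    exact and_congr (ihφ (Set.subset_union_left.trans hφ) B)
      (ihψ (Set.subset_union_right.trans hφ) B)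
  | ex x φ ih => exact exists_congr fun k => ih hφ _
  | know φ ih => exact exists_congr fun β => and_congr_left fun _ => associated_restrictPreds N p B β

theorem sat_restrictPreds_rel {Γ : Set (MFormula L)} {n : ℕ} (R : L.Relations n)
    (ts : Fin n → L.Term ℕ) (B : ℕ → N.carrier) :
    @Sat L Γ N.carrier (N.restrictPreds p).str (.rel R ts) B ↔ Sat Γ (.rel R ts) B ∧
      ((⟨n, R⟩ : Σ n, L.Relations n) ∉ p → ∀ i, Named L ((ts i).realize B)) := by
  simp only [Sat, realize_restrictPreds]
  exact Iff.rfl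

/-- The arguments of a ground atom denote named individuals, so the restriction removes none of its
instances. -/
theorem Interp.truths_restrictPreds : (N.restrictPreds p).truths = N.truths := by
  ext φ
  by_cases hφ : φ.IsGroundAtom
  · let B : ℕ → N.carrier := fun _ => Classical.arbitrary _
    rw [Interp.mem_truths_iff hφ ∅ B, Interp.mem_truths_iff (N := N.restrictPreds p) hφ ∅ B]
    obtain ⟨ha, hc⟩ := hφ
    cases φ with
    | equal t₁ t₂ => exact sat_restrictPreds N p (Set.empty_subset _) B
    | rel R ts =>
      refine (sat_restrictPreds_rel N p R ts B).trans
        (and_iff_left fun _ i => named_realize _ fun x hx => ?_)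
      have : x ∈ (MFormula.rel R ts).freeVars := by
        simp only [MFormula.freeVars, Finset.mem_biUnion, Finset.mem_univ, true_and]
        exact ⟨i, hx⟩
      rw [hc] at this
      simp at this
    | _ => exact ha.elim
  · exact ⟨fun h => (hφ h.1).elim, fun h => (hφ h.1).elim⟩

end RestrictPreds

/-! ### Grounding invariance -/

/-- For rules with epistemic bodies, or in the absence of variables, nothing has to be changed to
obtain a model of a program from a model of its grounding. -/
theorem mem_models_of_ground_of_named {χ : Emb} {Φ : Set (MFormula L)} {P : Program L}
    {F : Set (Σ n, L.Functions n)} {S : Set (MFormula L)} (hpos : P.IsPositive) {N : Interp L}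
    (hS : N.truths ⊆ S) (hN : N ∈ models (combine χ Φ (P.ground F)) S)
    (hnamed : ∀ r ∈ P.rules, ∀ B : ℕ → N.carrier, (∀ b ∈ r.pos, Sat S (embedPos χ b) B) →
      ∀ x, r.HasVar x → Named L (B x)) : N ∈ models (combine χ Φ P) S := by
  rw [mem_models_combine] at hN ⊢
  refine ⟨hN.1, fun r hr => (isModel_embedRule (hpos r hr)).2 fun B hB => ?_, isModel_UNA hS _⟩
  exact sat_embedHead_of_ground_instances hS (hpos r hr)
    (fun β hβ => hN.2.1 _ ⟨hβ, r, hr, β, rfl⟩) (hnamed r hr B hB) fun b hb => (hB b hb).of_embedPos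

/-- Without names there are no constants, so a well-formed program has predicates of arity 0 only.
This covers the case in which the substructure of named individuals would be empty. -/
theorem isEmpty_name_imp_isGround (hL : IsEmpty (Name L)) {P : Program L} (hP : P.WellFormed)
    {r : Rule L} (hr : r ∈ P.rules) : r.IsGround := by
  rintro x ⟨a, ha, hx⟩
  have hpos : 0 < a.arity := by
    rcases Nat.eq_zero_or_pos a.arity with h0 | h0
    · obtain ⟨n, p, ts⟩ := a
      obtain rfl : n = 0 := h0
      simp [Atom.vars] at hx
    · exact h0
  obtain ⟨c, -⟩ := hP.exists_constant ⟨_, hP.preds_mem r hr a ha, hpos⟩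
  exact hL.elim (.func c Fin.elim0)

theorem groundingInvariant_of_exists_models {χ : Emb}
    {C : Set (MFormula L) → Program L → Prop} (hΦ : ∀ Φ P, C Φ P → GHornTheory Φ)
    (hsafe : ∀ Φ P, C Φ P → P.IsSafe) (hpos : ∀ Φ P, C Φ P → P.IsPositive)
    (hC : ∀ Φ P, P.WellFormed → C Φ P → ∀ F S, ∀ N ∈ models (combine χ Φ (P.ground F)) S,
      N.truths ⊆ S → ∃ K ∈ models (combine χ Φ P) S, K.truths = N.truths) :
    GroundingInvariant χ C := by
  intro Φ P hP hCP F _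
  have hgpos : (P.ground F).IsPositive := by
    rintro _ ⟨-, r, hr, β, rfl⟩
    exact (hpos Φ P hCP r hr).applySubst β
  have hgsafe : (P.ground F).IsSafe := fun r hr => Rule.IsGround.isSafe hr.1
  have hprod : ∀ (Q : Program L), Q.IsPositive → Q.IsSafe → ∀ (S : Set (MFormula L))
      (I : Type (max u v)) [Nonempty I] (N : I → Interp L), (∀ i, N i ∈ models (combine χ Φ Q) S) →
      (Interp.prod N).truths ⊆ S → Interp.prod N ∈ models (combine χ Φ Q) S :=
    fun Q h₁ h₂ S I _ N hN hS => prod_mem_models_combine (hΦ Φ P hCP) h₁ h₂ hN hS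
  have hground : ∀ S, ∀ N ∈ models (combine χ Φ P) S, N.truths ⊆ S →
      ∃ K ∈ models (combine χ Φ (P.ground F)) S, K.truths = N.truths := by
    intro S N hN hS
    refine ⟨N, ?_, rfl⟩
    rw [mem_models_combine] at hN ⊢
    refine ⟨hN.1, ?_, isModel_UNA hS _⟩
    rintro _ ⟨hg, r, hr, β, rfl⟩
    exact isModel_ground_instance hS (hpos Φ P hCP r hr) (hN.2.1 r hr) hg
  have hprodP := hprod P (hpos Φ P hCP) (hsafe Φ P hCP)
  have hprodG := hprod (P.ground F) hgpos hgsafe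
  exact equivOga_of_isAtomicExpansion_iff (knowsAtoms_combine (hΦ Φ P hCP))
    (knowsAtoms_combine (hΦ Φ P hCP)) fun S =>
      ⟨.transfer (hprodP S) (hprodG S) (hground S) (hC Φ P hP hCP F S),
        .transfer (hprodG S) (hprodP S) (hC Φ P hP hCP F S) (hground S)⟩

theorem groundingInvariant_epistemic {χ : Emb} (hχ : χ = .EB ∨ χ = .EH)
    {C : Set (MFormula L) → Program L → Prop} (hΦ : ∀ Φ P, C Φ P → GHornTheory Φ)
    (hsafe : ∀ Φ P, C Φ P → P.IsSafe) (hpos : ∀ Φ P, C Φ P → P.IsPositive) :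
    GroundingInvariant χ C :=
  groundingInvariant_of_exists_models hΦ hsafe hpos fun Φ P _ hCP _ _ N hN hS =>
    ⟨N, mem_models_of_ground_of_named (hpos Φ P hCP) hS hN
      fun r hr _ hB _ hx => (hsafe Φ P hCP r hr).named hχ hB hx, rfl⟩

theorem groundingInvariant_HP_horn : GroundingInvariant (L := L) .HP fun Φ P =>
    HornTheory Φ ∧ P.IsSafe ∧ P.IsPositive := by
  refine groundingInvariant_of_exists_models (fun Φ P h φ hφ => (h.1 φ hφ).isGHorn)
    (fun Φ P h => h.2.1) (fun Φ P h => h.2.2) ?_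
  rintro Φ P hP ⟨hΦ, hsafe, hpos⟩ F S N hN hS
  rcases isEmpty_or_nonempty (Name L) with hL | ⟨⟨t⟩⟩
  · exact ⟨N, mem_models_of_ground_of_named hpos hS hN fun r hr _ _ x hx =>
      (isEmpty_name_imp_isGround hL hP hr x hx).elim, rfl⟩
  · refine ⟨N.namedPart t, ?_, N.truths_namedPart t⟩
    have hS' : (N.namedPart t).truths ⊆ S := by rwa [N.truths_namedPart t]
    refine mem_models_of_ground_of_named (F := F) hpos hS' ?_
      fun _ _ B _ x _ => named_namedSubstructure (B x)
    rw [mem_models_combine] at hN ⊢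
    refine ⟨fun φ hφ => (hΦ φ hφ).isModel_namedSubstructure (hN.1 φ hφ), ?_, isModel_UNA hS' _⟩
    intro r hr
    have hrpos : r.IsPositive := by
      obtain ⟨-, r, hr, β, rfl⟩ := hr
      exact (hpos r hr).applySubst β
    refine (isModel_embedRule hrpos).2 fun B hB => ?_
    exact (sat_namedSubstructure r.head.isAtomic_toFormula B).2
      ((isModel_embedRule hrpos).1 (hN.2.1 r hr) (fun x => (B x).1) fun b hb =>
        (sat_namedSubstructure b.isAtomic_toFormula B).1 (hB b hb))

theorem groundingInvariant_HP_dlSafe : GroundingInvariant (L := L) .HP fun Φ P =>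
    GHornTheory Φ ∧ P.IsDLSafe Φ ∧ P.IsPositive := by
  refine groundingInvariant_of_exists_models (fun Φ P h => h.1)
    (fun Φ P h => h.2.1.1) (fun Φ P h => h.2.2) ?_
  rintro Φ P hP ⟨hΦ, ⟨-, hdl⟩, hpos⟩ F S N hN hS
  let p : Set (Σ n, L.Relations n) := ⋃ φ ∈ Φ, φ.preds
  have hS' : (N.restrictPreds p).truths ⊆ S := by rwa [N.truths_restrictPreds p]
  refine ⟨N.restrictPreds p, ?_, N.truths_restrictPreds p⟩
  rw [mem_models_combine] at hN ⊢
  refine ⟨fun φ hφ B => ?_, fun r hr => ?_, isModel_UNA hS' _⟩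
  · exact (sat_restrictPreds N p (Set.subset_biUnion_of_mem (u := fun φ => φ.preds) hφ) B).2
      (hN.1 φ hφ B)
  -- The two interpretations share their carrier; the ascription makes `Named` below refer to the
  -- structure of `N`.
  · refine (isModel_embedRule (hpos r hr)).2 fun (B : ℕ → N.carrier) hB => ?_
    have hB' : ∀ b ∈ r.pos, _ := fun b hb => (sat_restrictPreds_rel N p b.pred b.args B).1 (hB b hb)
    have hnamed : ∀ x, r.HasVar x → Named L (B x) := by
      intro x hx
      obtain ⟨b, hb, hrule, i, hi⟩ := hdl r hr x hx
      -- The predicate of the rule atom `b` lies outside `p`, so its arguments are named. Since `x`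
      -- is itself an argument, and not merely a variable inside one, its value is named.
      have := (hB' b hb).2 (by simpa [p, Program.RuleAtom] using hrule) i
      rwa [hi] at this
    -- The head has to hold in `N` and, if its predicate was restricted, its arguments have to be
    -- named; the latter holds because terms in named individuals denote named individuals.
    refine (sat_restrictPreds_rel N p r.head.pred r.head.args B).2 ⟨?_, fun _ i => ?_⟩
    · exact sat_embedHead_of_ground_instances (χ := .HP) hS (hpos r hr)
        (fun β hβ => hN.2.1 _ ⟨hβ, r, hr, β, rfl⟩) hnamed fun b hb => (hB' b hb).1
    · refine named_realize _ fun x hx => hnamed x (Rule.hasVar_head ?_)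
      simp only [Atom.vars, Finset.mem_biUnion, Finset.mem_univ, true_and]
      exact ⟨i, hx⟩

end AEL

theorem proposition7p5 (L : FirstOrder.Language.{u, v}) :
    (∀ χ : AEL.Emb, χ = .EB ∨ χ = .EH →
      AEL.GroundingInvariant (L := L) χ fun Φ P =>
        AEL.GHornTheory Φ ∧ P.IsSafe ∧ P.IsPositive) ∧
    (∀ χ : AEL.Emb, χ = .HP ∨ χ = .EB ∨ χ = .EH →
      AEL.GroundingInvariant (L := L) χ fun Φ P =>
        AEL.HornTheory Φ ∧ P.IsSafe ∧ P.IsPositive) ∧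
    (∀ χ : AEL.Emb, χ = .HP ∨ χ = .EB ∨ χ = .EH →
      AEL.GroundingInvariant (L := L) χ fun Φ P =>
        AEL.GHornTheory Φ ∧ P.IsDLSafe Φ ∧ P.IsPositive) := by
  refine ⟨fun χ hχ => ?_, fun χ hχ => ?_, fun χ hχ => ?_⟩
  · exact AEL.groundingInvariant_epistemic hχ (fun _ _ h => h.1) (fun _ _ h => h.2.1)
      fun _ _ h => h.2.2
  · rcases hχ with rfl | hχ
    · exact AEL.groundingInvariant_HP_horn
    · exact AEL.groundingInvariant_epistemic hχ (fun _ _ h φ hφ => (h.1 φ hφ).isGHorn)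
        (fun _ _ h => h.2.1) fun _ _ h => h.2.2
  · rcases hχ with rfl | hχ
    · exact AEL.groundingInvariant_HP_dlSafe
    · exact AEL.groundingInvariant_epistemic hχ (fun _ _ h => h.1) (fun _ _ h => h.2.1.1)
        fun _ _ h => h.2.2
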